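/- Let $k>1$ be an integer and let $G$ be a simple graph (no loops or parallel edges) on $n\ge 1$ vertices. Let $c:E(G)\to\{1,\dots,n\}$ be a colouring of the edges of $G$, not necessarily proper, such that $|c^{-1}(i)|\ge 301\,k\log_2 k$ for every $i\in\{1,\dots,n\}$. Then $G$ contains a rainbow cycle of length at most $\lceil n/k\rceil$, that is, a cycle $C$ in $G$ of length at most $\lceil n/k\rceil$ such that $c(e)\ne c(f)$ for any two distinct edges $e,f$ of $C$. -/

import Mathlib

/-- A closed walk `p` of `G` is a rainbow cycle with respect to the edge colouring `c` if it is a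
cycle and any two distinct edges of it have distinct colours. -/
def SimpleGraph.Walk.IsRainbowCycle {V α : Type*} {G : SimpleGraph V} {v : V}
    (p : G.Walk v v) (c : G.edgeSet → α) : Prop :=
  p.IsCycle ∧
    ∀ e f : G.edgeSet, (e : Sym2 V) ∈ p.edges → (f : Sym2 V) ∈ p.edges → e ≠ f → c e ≠ c f

/-! It suffices to find a nonempty vertex set `S` with `|S| ≤ n/k` that spans at least `|S|`
colours: one edge of each colour inside `S` gives a graph on `S` with too many edges to be a forest,
and its cycle is rainbow.

Write `L = log₂ k`. Give a colour a centre if some vertex has degree at least `60kL` in it;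
otherwise the colour is spread out. Let `Z` be the set of vertices that are centres of no colour.

If `|Z| ≤ n/(8k)`, then, as there are `n` colours, the map from colours to centres is nearly
bijective. Put into `S` all exceptional vertices, an edge of each centreless colour and a small
transversal of the stars; each missed colour then has its own centre outside `S`
(`exists_spanning_of_few_noncentres`).

If `|Z| > n/(8k)`, pick vertices at random with probability `q = 1/(4k)`, lowered to `3q/4` on `Z`.
Each colour is still spanned with probability nearly `q`: by its star, whose centre is outside `Z`,
or by a second-moment bound. The expected number of colours thus exceeds the expected size by about
`q|Z|/4`, and an exponential moment makes sets larger than `n/k` negligible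
(`exists_spanning_of_many_noncentres`). -/

/-! ### Rainbow cycles from sets spanning many colours. -/

/-- A finite forest on a nonempty vertex set has fewer edges than vertices. -/
theorem SimpleGraph.IsAcyclic.card_edgeSet_lt {V : Type*} [Finite V] [Nonempty V]
    {G : SimpleGraph V} (hG : G.IsAcyclic) : Nat.card G.edgeSet < Nat.card V := by
  obtain ⟨F, hGF, -, hF⟩ :=
    (SimpleGraph.connected_top (V := V)).exists_isTree_le_of_le_of_isAcyclic le_top hG
  have h := (SimpleGraph.isTree_iff_connected_and_card.mp hF).2
  have h' : Nat.card G.edgeSet ≤ Nat.card F.edgeSet :=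
    Nat.card_mono (Set.toFinite _) (SimpleGraph.edgeSet_mono hGF)
  omega

/-- If at least `#S` colours appear on edges inside a nonempty vertex set `S`, then there is a
rainbow cycle of length at most `#S`. -/
theorem SimpleGraph.exists_isRainbowCycle_length_le_card {V α : Type*} {G : SimpleGraph V}
    (c : G.edgeSet → α) {S : Finset V} (hS : S.Nonempty) {I : Finset α} (hI : S.card ≤ I.card)
    (h : ∀ i ∈ I, ∃ u ∈ S, ∃ v ∈ S, ∃ huv : G.Adj u v, c ⟨s(u, v), huv⟩ = i) :
    ∃ (v : V) (p : G.Walk v v), p.IsRainbowCycle c ∧ p.length ≤ S.card := by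
  choose u hu v hv huv hc using fun i : I ↦ h i i.2
  have : Nonempty S := hS.to_subtype
  let e : I → Sym2 S := fun i ↦ s(⟨u i, hu i⟩, ⟨v i, hv i⟩)
  let H : SimpleGraph S := SimpleGraph.fromEdgeSet (Set.range e)
  have he : ∀ i : I, (e i).map Subtype.val = s(u i, v i) := fun i ↦ rfl
  have hmem : ∀ i : I, e i ∈ H.edgeSet := by
    intro i
    have : u i ≠ v i := (huv i).ne
    simp only [H, e, SimpleGraph.mem_edgeSet, SimpleGraph.fromEdgeSet_adj]
    exact ⟨⟨i, rfl⟩, fun h ↦ this (congrArg Subtype.val h)⟩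
  have hinj : Function.Injective fun i : I ↦ (⟨e i, hmem i⟩ : H.edgeSet) := by
    intro i j hij
    have h1 : s(u i, v i) = s(u j, v j) := by
      rw [← he, ← he, show e i = e j from congrArg Subtype.val hij]
    apply Subtype.ext
    rw [← hc i, ← hc j]
    exact congrArg c (Subtype.ext h1)
  have hcard : Nat.card I ≤ Nat.card H.edgeSet := Nat.card_le_card_of_injective _ hinj
  have hnot : ¬ H.IsAcyclic := by
    intro hH
    have := hH.card_edgeSet_lt
    simp only [Nat.card_eq_fintype_card, Fintype.card_coe] at this hcard
    omega
  have hadj : ∀ {x y : S}, H.Adj x y → ∃ i : I, e i = s(x, y) := by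
    intro x y hxy
    exact ((SimpleGraph.fromEdgeSet_adj _).mp hxy).1
  let φ : H →g G := ⟨Subtype.val, by
    intro x y hxy
    obtain ⟨i, hi⟩ := hadj hxy
    rw [← SimpleGraph.mem_edgeSet]
    have : s(x.1, y.1) = s(u i, v i) := by rw [← he, hi]; rfl
    rw [this]
    exact huv i⟩
  simp only [SimpleGraph.IsAcyclic, not_forall, not_not] at hnot
  obtain ⟨x, p, hp⟩ := hnot
  refine ⟨_, p.map φ, ⟨?_, ?_⟩, ?_⟩
  · exact hp.map Subtype.val_injective
  · have key : ∀ a : G.edgeSet, (a : Sym2 V) ∈ (p.map φ).edges →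
        ∃ i : I, (a : Sym2 V) = s(u i, v i) ∧ c a = i := by
      intro a ha
      rw [SimpleGraph.Walk.edges_map, List.mem_map] at ha
      obtain ⟨b, hb, hba⟩ := ha
      have hb' := p.edges_subset_edgeSet hb
      induction b with
      | h y z =>
        obtain ⟨i, hi⟩ := hadj hb'
        have h1 : (a : Sym2 V) = s(u i, v i) := by rw [← hba, ← he, hi]; rfl
        refine ⟨i, h1, ?_⟩
        rw [← hc i]
        exact congrArg c (Subtype.ext h1)
    intro a b ha hb hab hcab
    obtain ⟨i, hi, hi'⟩ := key a ha
    obtain ⟨j, hj, hj'⟩ := key b hb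
    have : i = j := Subtype.ext (by rw [← hi', ← hj', hcab])
    subst this
    exact hab (Subtype.ext (hi.trans hj.symm))
  · rw [SimpleGraph.Walk.length_map]
    have h1 := hp.support_nodup.length_le_card
    simpa using h1

/-! ### Random vertex sets. -/

/-- The expectation of `f S` when `S` is a random set of vertices containing each vertex `v`
independently with probability `p v`. -/
noncomputable def bernoulliExp {V : Type*} [Fintype V] [DecidableEq V] (p : V → ℝ)
    (f : Finset V → ℝ) : ℝ :=
  ∑ S, ((∏ v ∈ S, p v) * ∏ v ∈ Sᶜ, (1 - p v)) * f S

namespace bernoulliExp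

variable {V : Type*} [Fintype V] [DecidableEq V] {p : V → ℝ} {f g : Finset V → ℝ}

theorem add : bernoulliExp p (fun S ↦ f S + g S) = bernoulliExp p f + bernoulliExp p g := by
  simp only [bernoulliExp, mul_add, Finset.sum_add_distrib]

theorem sub : bernoulliExp p (fun S ↦ f S - g S) = bernoulliExp p f - bernoulliExp p g := by
  simp only [bernoulliExp, mul_sub, Finset.sum_sub_distrib]

theorem const_mul (a : ℝ) : bernoulliExp p (fun S ↦ a * f S) = a * bernoulliExp p f := by
  simp only [bernoulliExp, Finset.mul_sum]
  exact Finset.sum_congr rfl fun S _ ↦ by ring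

theorem sum {ι : Type*} (s : Finset ι) (F : ι → Finset V → ℝ) :
    bernoulliExp p (fun S ↦ ∑ i ∈ s, F i S) = ∑ i ∈ s, bernoulliExp p (F i) := by
  simp only [bernoulliExp, Finset.mul_sum]
  exact Finset.sum_comm

theorem mono (hp₀ : ∀ v, 0 ≤ p v) (hp₁ : ∀ v, p v ≤ 1) (h : ∀ S, f S ≤ g S) :
    bernoulliExp p f ≤ bernoulliExp p g := by
  refine Finset.sum_le_sum fun S _ ↦ mul_le_mul_of_nonneg_left (h S) ?_
  exact mul_nonneg (Finset.prod_nonneg fun v _ ↦ hp₀ v)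
    (Finset.prod_nonneg fun v _ ↦ sub_nonneg.mpr (hp₁ v))

/-- Independence: expanding the right side chooses, for each vertex, whether it lies in `S`. The
probabilities and moments below are specialisations or sums of these. -/
theorem prod (x y : V → ℝ) :
    bernoulliExp p (fun S ↦ (∏ v ∈ S, x v) * ∏ v ∈ Sᶜ, y v)
      = ∏ v, (p v * x v + (1 - p v) * y v) := by
  rw [Fintype.prod_add]
  refine Finset.sum_congr rfl fun S _ ↦ ?_
  rw [Finset.prod_mul_distrib, Finset.prod_mul_distrib]
  ring

theorem one : bernoulliExp p (fun _ ↦ 1) = 1 := by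
  simpa using prod (p := p) (fun _ ↦ 1) (fun _ ↦ 1)

/-- The probability that `A ⊆ S` and `B ∩ S = ∅`, for disjoint `A` and `B`. -/
theorem subset_and_disjoint {A B : Finset V} (hAB : Disjoint A B) :
    bernoulliExp p (fun S ↦ if A ⊆ S ∧ Disjoint B S then 1 else 0)
      = (∏ v ∈ A, p v) * ∏ v ∈ B, (1 - p v) := by
  have h1 : (fun S : Finset V ↦ if A ⊆ S ∧ Disjoint B S then (1 : ℝ) else 0) = fun S ↦
      (∏ v ∈ S, if v ∈ B then (0 : ℝ) else 1) * ∏ v ∈ Sᶜ, if v ∈ A then (0 : ℝ) else 1 := by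
    funext S
    have hB : (∏ v ∈ S, if v ∈ B then (0 : ℝ) else 1) = if Disjoint B S then 1 else 0 := by
      split_ifs with h
      · exact Finset.prod_eq_one fun v hv ↦ if_neg (Finset.disjoint_right.mp h hv)
      · obtain ⟨v, hvB, hvS⟩ := Finset.not_disjoint_iff.mp h
        exact Finset.prod_eq_zero hvS (if_pos hvB)
    have hA : (∏ v ∈ Sᶜ, if v ∈ A then (0 : ℝ) else 1) = if A ⊆ S then 1 else 0 := by
      split_ifs with h
      · exact Finset.prod_eq_one fun v hv ↦ if_neg fun hvA ↦ Finset.mem_compl.mp hv (h hvA)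
      · obtain ⟨v, hvA, hvS⟩ := Finset.not_subset.mp h
        exact Finset.prod_eq_zero (Finset.mem_compl.mpr hvS) (if_pos hvA)
    rw [hA, hB]
    by_cases h1 : A ⊆ S <;> by_cases h2 : Disjoint B S <;> simp [h1, h2]
  rw [h1, prod]
  have h2 : ∀ v, (p v * (if v ∈ B then (0 : ℝ) else 1) + (1 - p v) * if v ∈ A then 0 else 1)
      = (if v ∈ A then p v else 1) * if v ∈ B then 1 - p v else 1 := by
    intro v
    have : v ∈ A → v ∉ B := fun h ↦ Finset.disjoint_left.mp hAB h
    by_cases hA : v ∈ A <;> by_cases hB : v ∈ B <;> simp_all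
  simp only [h2, Finset.prod_mul_distrib, Finset.prod_ite_mem, Finset.univ_inter]

theorem subset (A : Finset V) :
    bernoulliExp p (fun S ↦ if A ⊆ S then 1 else 0) = ∏ v ∈ A, p v := by
  simpa using subset_and_disjoint (p := p) (Finset.disjoint_empty_right A)

theorem disjoint (B : Finset V) :
    bernoulliExp p (fun S ↦ if Disjoint B S then 1 else 0) = ∏ v ∈ B, (1 - p v) := by
  simpa using subset_and_disjoint (p := p) (Finset.disjoint_empty_left B)

theorem mem (v : V) : bernoulliExp p (fun S ↦ if v ∈ S then 1 else 0) = p v := by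
  simpa using subset (p := p) {v}

theorem card : bernoulliExp p (fun S ↦ (S.card : ℝ)) = ∑ v, p v := by
  have : (fun S : Finset V ↦ (S.card : ℝ)) = fun S ↦ ∑ v, if v ∈ S then 1 else 0 := by
    funext S; simp
  rw [this, sum]
  exact Finset.sum_congr rfl fun v _ ↦ mem v

theorem pow_card (a : ℝ) :
    bernoulliExp p (fun S ↦ a ^ S.card) = ∏ v, (1 + (a - 1) * p v) := by
  have := prod (p := p) (fun _ ↦ a) (fun _ ↦ 1)
  simp only [Finset.prod_const, one_pow, mul_one] at this
  rw [this]
  exact Finset.prod_congr rfl fun v _ ↦ by ring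

end bernoulliExp

/-! ### Probability that a random set spans an edge. -/

/-- The graph `H` has an edge with both ends in `S`. -/
def SimpleGraph.HasEdgeIn {V : Type*} (H : SimpleGraph V) (S : Finset V) : Prop :=
  ∃ u ∈ S, ∃ v ∈ S, H.Adj u v

/-- Each vertex of `{x, y}` outside `{u, v}` costs a factor at most `q`; the three terms cover zero,
one and two shared vertices. -/
theorem prod_pair_union_pair_le {V : Type*} [DecidableEq V] {p : V → ℝ} {q : ℝ} (hp₀ : ∀ v, 0 ≤ p v)
    (hpq : ∀ v, p v ≤ q) {u v x y : V} (huv : u ≠ v) (hxy : x ≠ y) :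
    ∏ w ∈ {u, v} ∪ {x, y}, p w ≤ p u * p v *
      (q ^ 2 + q * ((if x = u then 1 else 0) + (if x = v then 1 else 0)
        + (if y = u then 1 else 0) + (if y = v then 1 else 0))
        + ((if x = u ∧ y = v then 1 else 0) + if x = v ∧ y = u then 1 else 0)) := by
  have hq : 0 ≤ q := (hp₀ u).trans (hpq u)
  have hsplit : ∏ w ∈ {u, v} ∪ {x, y}, p w
      = p u * p v * ∏ w ∈ ({x, y} : Finset V) \ {u, v}, p w := by
    rw [← Finset.union_sdiff_self_eq_union, Finset.prod_union Finset.disjoint_sdiff,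
      Finset.prod_pair huv]
  rw [hsplit]
  refine mul_le_mul_of_nonneg_left ?_ (mul_nonneg (hp₀ u) (hp₀ v))
  have hle : ∏ w ∈ ({x, y} : Finset V) \ {u, v}, p w ≤ q ^ (({x, y} : Finset V) \ {u, v}).card :=
    (Finset.prod_le_prod (fun w _ ↦ hp₀ w) fun w _ ↦ hpq w).trans_eq (Finset.prod_const q)
  refine hle.trans ?_
  by_cases hx : x = u ∨ x = v <;> by_cases hy : y = u ∨ y = v
  · have : ({x, y} : Finset V) \ {u, v} = ∅ := by
      ext w; simp; grind
    rw [this, Finset.card_empty, pow_zero]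
    have : (x = u ∧ y = v) ∨ (x = v ∧ y = u) := by grind
    rcases this with ⟨rfl, rfl⟩ | ⟨rfl, rfl⟩
    · simp [huv, huv.symm]; positivity
    · simp [huv, huv.symm]; positivity
  · have : ({x, y} : Finset V) \ {u, v} = {y} := by
      ext w; simp; grind
    rw [this, Finset.card_singleton, pow_one]
    have : q * 1 ≤ q * ((if x = u then 1 else 0) + (if x = v then 1 else 0)
        + (if y = u then 1 else 0) + (if y = v then 1 else 0)) := by
      refine mul_le_mul_of_nonneg_left ?_ hq
      rcases hx with hx | hx <;> simp only [hx, if_true] <;> split_ifs <;> norm_num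
    split_ifs at this ⊢ <;> nlinarith
  · have : ({x, y} : Finset V) \ {u, v} = {x} := by
      ext w; simp; grind
    rw [this, Finset.card_singleton, pow_one]
    have : q * 1 ≤ q * ((if x = u then 1 else 0) + (if x = v then 1 else 0)
        + (if y = u then 1 else 0) + (if y = v then 1 else 0)) := by
      refine mul_le_mul_of_nonneg_left ?_ hq
      rcases hy with hy | hy <;> simp only [hy, if_true] <;> split_ifs <;> norm_num
    split_ifs at this ⊢ <;> nlinarith
  · have : ({x, y} : Finset V) \ {u, v} = {x, y} := by
      ext w; simp; grind
    rw [this, Finset.card_pair hxy]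
    push Not at hx hy
    simp [hx, hy]

section HasEdgeIn

variable {V : Type*} [Fintype V] [DecidableEq V] (H : SimpleGraph V) [DecidableRel H.Adj]
  {p : V → ℝ}

open Classical in
/-- Lower bound, from the star at `v`, for the probability that a random set spans an edge. -/
theorem SimpleGraph.le_bernoulliExp_hasEdgeIn_star (hp₀ : ∀ v, 0 ≤ p v) (hp₁ : ∀ v, p v ≤ 1)
    (v : V) :
    p v * (1 - ∏ u ∈ H.neighborFinset v, (1 - p u))
      ≤ bernoulliExp p (fun S ↦ if H.HasEdgeIn S then 1 else 0) := by
  have hd : Disjoint {v} (H.neighborFinset v) := by simp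
  have h1 := bernoulliExp.subset_and_disjoint (p := p) hd
  have h2 := bernoulliExp.mem (p := p) v
  calc _ = bernoulliExp p (fun S ↦ (if v ∈ S then 1 else 0) -
        if {v} ⊆ S ∧ Disjoint (H.neighborFinset v) S then 1 else 0) := by
        rw [bernoulliExp.sub, h1, h2, Finset.prod_singleton]; ring
    _ ≤ _ := by
        refine bernoulliExp.mono hp₀ hp₁ fun S ↦ ?_
        by_cases hv : v ∈ S
        · by_cases hS : Disjoint (H.neighborFinset v) S
          · simp only [hv, hS, Finset.singleton_subset_iff, and_self, if_true, sub_self]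
            split_ifs <;> norm_num
          · obtain ⟨u, hu, huS⟩ := Finset.not_disjoint_iff.mp hS
            have : H.HasEdgeIn S := ⟨v, hv, u, huS, by simpa using hu⟩
            simp [hv, hS, this]
        · simp only [hv, Finset.singleton_subset_iff, false_and, if_false, sub_self]
          split_ifs <;> norm_num

open Classical in
/-- Second-moment lower bound for the probability that a random set spans an edge. -/
theorem SimpleGraph.le_bernoulliExp_hasEdgeIn {q r t m : ℝ} (hr : 0 ≤ r) (hrp : ∀ v, r ≤ p v)
    (hpq : ∀ v, p v ≤ q) (hq : q ≤ 1) (ht : ∀ v, (H.degree v : ℝ) ≤ t)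
    (hm : ∑ v, (H.degree v : ℝ) = m) (ht₀ : 0 ≤ t) (hq₀ : 0 ≤ q) :
    m * r ^ 2 / (2 + 4 * t * q + m * q ^ 2)
      ≤ bernoulliExp p (fun S ↦ if H.HasEdgeIn S then 1 else 0) := by
  have hp₀ : ∀ v, 0 ≤ p v := fun v ↦ hr.trans (hrp v)
  have hp₁ : ∀ v, p v ≤ 1 := fun v ↦ (hpq v).trans hq
  have hm₀ : 0 ≤ m := hm ▸ Finset.sum_nonneg fun v _ ↦ Nat.cast_nonneg _
  -- Edges are counted as ordered pairs, so `#D` is the degree sum `m`, and each edge coincides with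
  -- two pairs: the `2` in `B`.
  set D : Finset (V × V) := Finset.univ.filter fun d ↦ H.Adj d.1 d.2 with hD
  have hsum : ∀ F : V → V → ℝ, ∑ d ∈ D, F d.1 d.2 = ∑ x, ∑ y ∈ H.neighborFinset x, F x y := by
    intro F
    rw [hD, Finset.sum_filter, Fintype.sum_prod_type]
    refine Finset.sum_congr rfl fun x _ ↦ ?_
    rw [← Finset.sum_filter]
    exact Finset.sum_congr (by ext y; simp) fun _ _ ↦ rfl
  have hsum' : ∀ F : V → V → ℝ, ∑ d ∈ D, F d.1 d.2 = ∑ y, ∑ x ∈ H.neighborFinset y, F x y := by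
    intro F
    rw [hD, Finset.sum_filter, Fintype.sum_prod_type_right]
    refine Finset.sum_congr rfl fun x _ ↦ ?_
    rw [← Finset.sum_filter]
    exact Finset.sum_congr (by ext y; simp [H.adj_comm]) fun _ _ ↦ rfl
  have hcard : (D.card : ℝ) = m := by
    have := hsum fun _ _ ↦ 1
    simp only [Finset.sum_const, nsmul_eq_mul, mul_one, card_neighborFinset_eq_degree] at this
    rw [this, hm]
  have hx : ∀ u, ∑ d ∈ D, (if d.1 = u then (1 : ℝ) else 0) ≤ t := by
    intro u
    rw [hsum fun x _ ↦ if x = u then (1 : ℝ) else 0]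
    simpa using ht u
  have hy : ∀ u, ∑ d ∈ D, (if d.2 = u then (1 : ℝ) else 0) ≤ t := by
    intro u
    rw [hsum' fun _ y ↦ if y = u then (1 : ℝ) else 0]
    simpa using ht u
  have hxy : ∀ u v, ∑ d ∈ D, (if d.1 = u ∧ d.2 = v then (1 : ℝ) else 0) ≤ 1 := by
    intro u v
    rw [Finset.sum_boole]
    norm_cast
    rw [Finset.card_le_one]
    rintro ⟨a, b⟩ ha ⟨a', b'⟩ hb
    simp_all
  set B : ℝ := 2 + 4 * t * q + m * q ^ 2 with hB
  let N : Finset V → ℝ := fun S ↦ ∑ d ∈ D, if {d.1, d.2} ⊆ S then (1 : ℝ) else 0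
  have hEN : bernoulliExp p N = ∑ d ∈ D, p d.1 * p d.2 := by
    simp only [N]
    rw [bernoulliExp.sum]
    refine Finset.sum_congr rfl fun d hd ↦ ?_
    rw [bernoulliExp.subset, Finset.prod_pair]
    exact (Finset.mem_filter.mp hd).2.ne
  have hEN₂ : bernoulliExp p (fun S ↦ N S ^ 2) ≤ B * bernoulliExp p N := by
    have h1 : (fun S ↦ N S ^ 2) = fun S ↦ ∑ d ∈ D, ∑ d' ∈ D,
        if {d.1, d.2} ∪ {d'.1, d'.2} ⊆ S then (1 : ℝ) else 0 := by
      funext S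
      simp only [N, sq, Finset.sum_mul_sum]
      refine Finset.sum_congr rfl fun d _ ↦ Finset.sum_congr rfl fun d' _ ↦ ?_
      simp only [Finset.union_subset_iff, ite_and]
      split_ifs <;> norm_num
    rw [h1, bernoulliExp.sum, hEN, Finset.mul_sum]
    refine Finset.sum_le_sum fun d hd ↦ ?_
    rw [bernoulliExp.sum]
    calc _ ≤ ∑ d' ∈ D, p d.1 * p d.2 *
          (q ^ 2 + q * ((if d'.1 = d.1 then 1 else 0) + (if d'.1 = d.2 then 1 else 0)
          + (if d'.2 = d.1 then 1 else 0) + (if d'.2 = d.2 then 1 else 0))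
          + ((if d'.1 = d.1 ∧ d'.2 = d.2 then 1 else 0)
            + if d'.1 = d.2 ∧ d'.2 = d.1 then 1 else 0)) := by
          refine Finset.sum_le_sum fun d' hd' ↦ ?_
          rw [bernoulliExp.subset]
          exact prod_pair_union_pair_le hp₀ hpq (Finset.mem_filter.mp hd).2.ne
            (Finset.mem_filter.mp hd').2.ne
      _ ≤ p d.1 * p d.2 * B := by
          rw [← Finset.mul_sum]
          refine mul_le_mul_of_nonneg_left ?_ (mul_nonneg (hp₀ _) (hp₀ _))
          simp only [Finset.sum_add_distrib, ← Finset.mul_sum, Finset.sum_const, nsmul_eq_mul,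
            hcard]
          have := mul_le_mul_of_nonneg_left
            (add_le_add (add_le_add (add_le_add (hx d.1) (hx d.2)) (hy d.1)) (hy d.2)) hq₀
          have h3 := hxy d.1 d.2
          have h4 := hxy d.2 d.1
          rw [hB]
          linarith
      _ = B * (p d.1 * p d.2) := mul_comm _ _
  have hEN' : m * r ^ 2 ≤ bernoulliExp p N := by
    rw [hEN, ← hcard, ← nsmul_eq_mul]
    refine Finset.card_nsmul_le_sum _ _ _ fun d _ ↦ ?_
    rw [sq]
    exact mul_le_mul (hrp _) (hrp _) hr (hp₀ _)
  have hBpos : 0 < B := by rw [hB]; positivity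
  -- With `x = N S / B` this is `2x - x² ≤ 1`, and both sides vanish suitably when `N S = 0`.
  have hpt : ∀ S, 2 * B⁻¹ * N S - B⁻¹ ^ 2 * N S ^ 2 ≤ if H.HasEdgeIn S then 1 else 0 := by
    intro S
    split_ifs with h
    · nlinarith [sq_nonneg (B⁻¹ * N S - 1)]
    · have : N S = 0 := Finset.sum_eq_zero fun d hd ↦ if_neg fun hS ↦ h
        ⟨d.1, hS (by simp), d.2, hS (by simp), (Finset.mem_filter.mp hd).2⟩
      simp [this]
  refine le_trans ?_ (bernoulliExp.mono hp₀ hp₁ hpt)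
  rw [bernoulliExp.sub, bernoulliExp.const_mul, bernoulliExp.const_mul]
  calc _ ≤ bernoulliExp p N / B := div_le_div_of_nonneg_right hEN' hBpos.le
    _ = 2 * B⁻¹ * bernoulliExp p N - B⁻¹ ^ 2 * (B * bernoulliExp p N) := by field_simp; ring
    _ ≤ _ := sub_le_sub_left (mul_le_mul_of_nonneg_left hEN₂ (by positivity)) _

end HasEdgeIn

/-! ### Numerical estimates and small transversals. -/

theorem bernoulliExp.exists_le {V : Type*} [Fintype V] [DecidableEq V] {p : V → ℝ}
    (hp₀ : ∀ v, 0 ≤ p v) (hp₁ : ∀ v, p v ≤ 1) (f : Finset V → ℝ) :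
    ∃ S, f S ≤ bernoulliExp p f := by
  obtain ⟨S, hS⟩ := Finite.exists_min f
  refine ⟨S, ?_⟩
  have h := bernoulliExp.mono hp₀ hp₁ hS
  have h1 := bernoulliExp.const_mul (p := p) (f := fun _ ↦ 1) (f S)
  simp only [mul_one, bernoulliExp.one] at h1
  rwa [h1] at h

theorem Real.log_le_logb_two {x : ℝ} (hx : 1 ≤ x) : Real.log x ≤ Real.logb 2 x := by
  rw [Real.logb, le_div_iff₀ (Real.log_pos one_lt_two)]
  nlinarith [Real.log_nonneg hx, Real.log_two_lt_d9]

theorem one_le_logb_two_natCast {k : ℕ} (hk : 1 < k) : 1 ≤ Real.logb 2 (k : ℝ) := by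
  have h2 : (2 : ℝ) ≤ k := by exact_mod_cast hk
  rw [Real.le_logb_iff_rpow_le one_lt_two (by linarith)]
  simpa using h2

theorem exp_neg_le_inv_pow {k : ℕ} (hk : 1 < k) (a : ℕ) {x : ℝ}
    (h : a * Real.logb 2 (k : ℝ) ≤ x) : Real.exp (-x) ≤ ((k : ℝ) ^ a)⁻¹ := by
  have h1 : (1 : ℝ) < k := by exact_mod_cast hk
  have h2 := Real.log_le_logb_two h1.le
  have h3 : (k : ℝ) ^ a = Real.exp (a * Real.log k) := by
    rw [Real.exp_nat_mul, Real.exp_log (by linarith)]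
  rw [h3, ← Real.exp_neg]
  refine Real.exp_le_exp.mpr (neg_le_neg (le_trans ?_ h))
  exact mul_le_mul_of_nonneg_left h2 (Nat.cast_nonneg a)

theorem prod_one_sub_le_inv_pow {V : Type*} {p : V → ℝ} {A : Finset V} {k : ℕ} (hk : 1 < k)
    (a : ℕ) {x : ℝ} (hp₁ : ∀ v, p v ≤ 1) (hx : ∀ v, x ≤ p v)
    (h : a * Real.logb 2 (k : ℝ) ≤ x * A.card) :
    ∏ v ∈ A, (1 - p v) ≤ ((k : ℝ) ^ a)⁻¹ := by
  refine le_trans ?_ (exp_neg_le_inv_pow hk a h)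
  calc ∏ v ∈ A, (1 - p v) ≤ ∏ _v ∈ A, Real.exp (-x) := by
        refine Finset.prod_le_prod (fun v _ ↦ sub_nonneg.mpr (hp₁ v)) fun v _ ↦ ?_
        have := Real.add_one_le_exp (-x)
        linarith [hx v]
    _ = _ := by
        rw [Finset.prod_const, ← Real.exp_nat_mul]
        congr 1; ring

/-- A family of at most `#V` large sets has a transversal of size at most `#V / (2k)`. -/
theorem exists_transversal_card_le {V ι : Type*} [Fintype V] [DecidableEq V] [Nonempty V] {k : ℕ}
    (hk : 1 < k)
    (I : Finset ι) (hI : I.card ≤ Fintype.card V) (A : ι → Finset V)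
    (hA : ∀ i ∈ I, 60 * k * Real.logb 2 (k : ℝ) ≤ (A i).card) :
    ∃ T : Finset V, (T.card : ℝ) ≤ Fintype.card V / (2 * k) ∧ ∀ i ∈ I, ∃ v ∈ A i, v ∈ T := by
  classical
  have hk2 : (2 : ℝ) ≤ k := by exact_mod_cast hk
  have hL := one_le_logb_two_natCast hk
  set L := Real.logb 2 (k : ℝ)
  set n : ℝ := (Fintype.card V : ℝ) with hn
  have hq₁ : 1 / (4 * (k : ℝ)) ≤ 1 := by rw [div_le_one (by linarith)]; linarith
  -- The random set and the sets it misses each contribute at most `n/(4k)` in expectation; every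
  -- missed set is repaired with one vertex.
  obtain ⟨T, hT⟩ := bernoulliExp.exists_le (V := V) (p := fun _ ↦ 1 / (4 * (k : ℝ)))
    (fun _ ↦ by positivity) (fun _ ↦ hq₁)
    (fun S ↦ (S.card : ℝ) + ∑ i ∈ I, if Disjoint (A i) S then 1 else 0)
  rw [bernoulliExp.add, bernoulliExp.card, bernoulliExp.sum] at hT
  have hbound : ∑ i ∈ I, bernoulliExp (V := V) (fun _ ↦ 1 / (4 * (k : ℝ)))
      (fun S ↦ if Disjoint (A i) S then 1 else 0) ≤ n * (1 / (4 * k)) := by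
    calc _ ≤ ∑ i ∈ I, 1 / (4 * (k : ℝ)) := by
          refine Finset.sum_le_sum fun i hi ↦ ?_
          rw [bernoulliExp.disjoint]
          refine (prod_one_sub_le_inv_pow hk 3 (fun _ ↦ hq₁) (fun _ ↦ le_rfl) ?_).trans ?_
          · have := hA i hi
            rw [one_div_mul_eq_div, le_div_iff₀ (by linarith)]
            push_cast
            nlinarith [mul_nonneg (by linarith : (0 : ℝ) ≤ k) (by linarith : (0 : ℝ) ≤ L)]
          · rw [← one_div]
            refine one_div_le_one_div_of_le (by linarith) ?_
            nlinarith [mul_nonneg (by linarith : (0 : ℝ) ≤ k) (mul_nonneg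
              (by linarith : (0 : ℝ) ≤ k - 2) (by linarith : (0 : ℝ) ≤ k + 2))]
      _ ≤ _ := by
          rw [Finset.sum_const, nsmul_eq_mul]
          exact mul_le_mul_of_nonneg_right (by rw [hn]; exact_mod_cast hI) (by positivity)
  have hne : ∀ i ∈ I, (A i).Nonempty := by
    intro i hi
    rw [← Finset.card_pos]
    have := hA i hi
    have h0 : (0 : ℝ) < 60 * k * L := by positivity
    exact_mod_cast h0.trans_le this
  choose! g hg using hne
  refine ⟨T ∪ (I.filter fun i ↦ Disjoint (A i) T).image g, ?_, ?_⟩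
  · have h1 : ((T ∪ (I.filter fun i ↦ Disjoint (A i) T).image g).card : ℝ)
        ≤ T.card + (I.filter fun i ↦ Disjoint (A i) T).card := by
      exact_mod_cast (Finset.card_union_le _ _).trans
        (Nat.add_le_add_left Finset.card_image_le _)
    rw [Finset.sum_boole] at hT
    simp only [Finset.sum_const, Finset.card_univ, nsmul_eq_mul, ← hn] at hT
    have h2 : n / (2 * k) = n * (1 / (4 * k)) + n * (1 / (4 * k)) := by field_simp; ring
    linarith
  · intro i hi
    by_cases h : Disjoint (A i) T
    · exact ⟨g i, hg i hi, Finset.mem_union_right _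
        (Finset.mem_image_of_mem g (Finset.mem_filter.mpr ⟨hi, h⟩))⟩
    · obtain ⟨v, hv, hvT⟩ := Finset.not_disjoint_iff.mp h
      exact ⟨v, hv, Finset.mem_union_left _ hvT⟩

/-! ### Sets spanning at least as many colours as vertices. -/

section Spanning

variable {V ι : Type*} [Fintype V] [DecidableEq V] [Fintype ι]
  {H : ι → SimpleGraph V} [∀ i, DecidableRel (H i).Adj] {k : ℕ} {ctr : ι → Option V}

open Classical in
/-- If few vertices are centres of no colour, a transversal of the stars together with all
exceptional vertices spans at least as many colours as it has vertices. -/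
theorem exists_spanning_of_few_noncentres (hcard : Fintype.card ι = Fintype.card V) (hk : 1 < k)
    [Nonempty V] (hedge : ∀ i, ∃ u v, (H i).Adj u v)
    (hctr : ∀ i v, ctr i = some v → 60 * k * Real.logb 2 (k : ℝ) ≤ (H i).degree v)
    {Z : Finset V} (hZmem : ∀ v, v ∈ Z ↔ ∀ i, ctr i ≠ some v)
    (hZ : (Z.card : ℝ) ≤ Fintype.card V / (8 * k)) :
    ∃ S : Finset V, S.Nonempty ∧ (S.card : ℝ) ≤ Fintype.card V / k ∧
      S.card ≤ (Finset.univ.filter fun i ↦ (H i).HasEdgeIn S).card := by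
  choose a b hab using hedge
  let d : V → ℕ := fun v ↦ (Finset.univ.filter fun i ↦ ctr i = some v).card
  let R : Finset ι := Finset.univ.filter fun i ↦ ctr i = none
  let M : Finset V := Finset.univ.filter fun v ↦ 2 ≤ d v
  let A : ι → Finset V := fun i ↦ (ctr i).elim ∅ fun v ↦ (H i).neighborFinset v
  have hd0 : ∀ v, d v = 0 ↔ v ∈ Z := by
    intro v
    simp [d, hZmem, Finset.filter_eq_empty_iff]
  have hdsum : ∑ v, d v + R.card = Fintype.card V := by
    have h1 : (Finset.univ : Finset ι).card
        = ∑ o : Option V, (Finset.univ.filter fun i ↦ ctr i = o).card :=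
      Finset.card_eq_sum_card_fiberwise fun _ _ ↦ Finset.mem_univ _
    rw [Fintype.sum_option, Finset.card_univ, hcard] at h1
    rw [h1, add_comm]
  have hMR : M.card + R.card ≤ Z.card := by
    -- Pointwise, `1 + [d v ≥ 2] ≤ d v + [d v = 0]`.
    have h1 : Fintype.card V + M.card ≤ ∑ v, d v + Z.card := by
      have hM : M.card = ∑ v, if 2 ≤ d v then 1 else 0 := by rw [Finset.card_filter]
      have hZ' : Z.card = ∑ v, if v ∈ Z then 1 else 0 := by simp
      have hV : Fintype.card V = ∑ _v : V, 1 := by simp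
      rw [hM, hZ', hV, ← Finset.sum_add_distrib, ← Finset.sum_add_distrib]
      refine Finset.sum_le_sum fun v _ ↦ ?_
      have := hd0 v
      split_ifs <;> grind
    omega
  obtain ⟨T, hTcard, hT⟩ := exists_transversal_card_le hk
    (Finset.univ.filter fun i ↦ ctr i ≠ none)
    ((Finset.card_le_univ _).trans_eq hcard) A (by
      intro i hi
      obtain ⟨v, hv⟩ := Option.ne_none_iff_exists'.mp (Finset.mem_filter.mp hi).2
      simpa [A, hv] using hctr i v hv)
  let S : Finset V := Z ∪ M ∪ (R.image a ∪ R.image b) ∪ T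
  have hZS : ∀ v ∈ Z, v ∈ S := fun v hv ↦ by simp [S, hv]
  have hMS : ∀ v ∈ M, v ∈ S := fun v hv ↦ by simp [S, hv]
  have hspan : ∀ i, ¬ (H i).HasEdgeIn S → ∃ v, v ∉ S ∧ ctr i = some v := by
    intro i hi
    rcases hc : ctr i with _ | v
    · have hiR : i ∈ R := by simp [R, hc]
      refine (hi ⟨a i, ?_, b i, ?_, hab i⟩).elim
      · simp only [S, Finset.mem_union]
        exact Or.inl (Or.inr (Or.inl (Finset.mem_image_of_mem a hiR)))
      · simp only [S, Finset.mem_union]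
        exact Or.inl (Or.inr (Or.inr (Finset.mem_image_of_mem b hiR)))
    · refine ⟨v, fun hv ↦ hi ?_, rfl⟩
      obtain ⟨u, hu, huT⟩ := hT i (by simp [hc])
      refine ⟨v, hv, u, Finset.mem_union_right _ huT, ?_⟩
      simpa [A, hc] using hu
  have hcompl : (Finset.univ.filter fun i ↦ ¬ (H i).HasEdgeIn S).card ≤ Sᶜ.card := by
    choose! f hf hf' using hspan
    refine Finset.card_le_card_of_injOn f (fun i hi ↦ ?_) fun i hi j hj hij ↦ ?_
    · simpa using hf i (by simpa using hi)
    · have hi' : ¬ (H i).HasEdgeIn S := by simpa using hi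
      have hj' : ¬ (H j).HasEdgeIn S := by simpa using hj
      -- A centre outside `S` is not in `M`, so it serves one colour only.
      have h1 : d (f i) ≤ 1 := by
        by_contra h
        exact hf i hi' (hMS _ (by simp only [M, Finset.mem_filter_univ]; omega))
      refine Finset.card_le_one.mp h1 i ?_ j ?_
      · simpa using hf' i hi'
      · simpa [hij] using hf' j hj'
  have hle : S.card ≤ (Finset.univ.filter fun i ↦ (H i).HasEdgeIn S).card := by
    have h1 := Finset.card_filter_add_card_filter_not (s := (Finset.univ : Finset ι))
      (fun i ↦ (H i).HasEdgeIn S)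
    rw [Finset.card_univ, hcard] at h1
    have h2 := Finset.card_add_card_compl S
    omega
  refine ⟨S, ?_, ?_, hle⟩
  · by_contra hS
    rw [Finset.not_nonempty_iff_eq_empty] at hS
    obtain ⟨v⟩ := ‹Nonempty V›
    have : d v ≠ 0 := fun h ↦ by simpa [hS] using hZS v ((hd0 v).mp h)
    obtain ⟨i, hi⟩ := Finset.card_pos.mp (Nat.pos_of_ne_zero this)
    obtain ⟨u, -, huT⟩ := hT i (by simp_all)
    have : u ∈ S := Finset.mem_union_right _ huT
    simp [hS] at this
  · have h1 : S.card ≤ Z.card + M.card + (R.card + R.card) + T.card := by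
      refine (Finset.card_union_le _ _).trans (Nat.add_le_add_right ?_ _)
      refine (Finset.card_union_le _ _).trans (Nat.add_le_add (Finset.card_union_le _ _) ?_)
      exact (Finset.card_union_le _ _).trans
        (Nat.add_le_add Finset.card_image_le Finset.card_image_le)
    have h2 : (S.card : ℝ) ≤ 3 * Z.card + T.card := by
      have : S.card ≤ 3 * Z.card + T.card := by omega
      exact_mod_cast this
    have hk0 : (0 : ℝ) < k := by exact_mod_cast (by omega : 0 < k)
    have h3 : (Fintype.card V : ℝ) / k = 3 * (Fintype.card V / (8 * k)) + Fintype.card V / (2 * k)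
        + Fintype.card V / (8 * k) := by field_simp; ring
    have h4 : (0 : ℝ) ≤ Fintype.card V / (8 * k) := by positivity
    linarith

open Classical in
/-- If many vertices are centres of no colour, then a random set that avoids them slightly spans
more colours than it has vertices. -/
theorem exists_spanning_of_many_noncentres (hcard : Fintype.card ι = Fintype.card V) (hk : 1 < k)
    [Nonempty V] (hn : 602 * k * Real.logb 2 (k : ℝ) ≤ Fintype.card V)
    (hH : ∀ i, 602 * k * Real.logb 2 (k : ℝ) ≤ ∑ v, ((H i).degree v : ℝ))
    (hctr : ∀ i v, ctr i = some v → 60 * k * Real.logb 2 (k : ℝ) ≤ (H i).degree v)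
    (hnone : ∀ i, ctr i = none → ∀ v, ((H i).degree v : ℝ) ≤ 60 * k * Real.logb 2 (k : ℝ))
    {Z : Finset V} (hZmem : ∀ v, v ∈ Z ↔ ∀ i, ctr i ≠ some v)
    (hZ : Fintype.card V / (8 * k) < (Z.card : ℝ)) :
    ∃ S : Finset V, S.Nonempty ∧ (S.card : ℝ) ≤ Fintype.card V / k ∧
      S.card ≤ (Finset.univ.filter fun i ↦ (H i).HasEdgeIn S).card := by
  have hk2 : (2 : ℝ) ≤ k := by exact_mod_cast hk
  have hk0 : (0 : ℝ) < k := by linarith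
  have hL := one_le_logb_two_natCast hk
  set L := Real.logb 2 (k : ℝ) with hLdef
  set n : ℝ := (Fintype.card V : ℝ) with hndef
  have hn0 : 0 < n := by rw [hndef]; exact_mod_cast Fintype.card_pos
  set q : ℝ := 1 / (4 * k) with hq
  have hqk : q * k = 1 / 4 := by rw [hq]; field_simp
  have hq0 : 0 < q := by positivity
  have hq8 : q ≤ 1 / 8 := by nlinarith
  let p : V → ℝ := fun v ↦ if v ∈ Z then 3 / 4 * q else q
  have hpq : ∀ v, p v ≤ q := fun v ↦ by simp only [p]; split_ifs <;> linarith
  have hrp : ∀ v, 3 / 4 * q ≤ p v := fun v ↦ by simp only [p]; split_ifs <;> linarith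
  have hp₀ : ∀ v, 0 ≤ p v := fun v ↦ le_trans (by positivity) (hrp v)
  have hp₁ : ∀ v, p v ≤ 1 := fun v ↦ (hpq v).trans (by linarith)
  have hsurv : ∀ i, q * (1 - ((k : ℝ) ^ 11)⁻¹)
      ≤ bernoulliExp p (fun S ↦ if (H i).HasEdgeIn S then 1 else 0) := by
    intro i
    rcases hc : ctr i with _ | v
    · have h1 := (H i).le_bernoulliExp_hasEdgeIn (by positivity) hrp hpq (by linarith)
        (hnone i hc) rfl (by positivity) hq0.le
      refine le_trans ?_ h1
      have hm := hH i
      set m := ∑ v, ((H i).degree v : ℝ)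
      have hmq : 301 / 2 * L ≤ m * q := by
        have := mul_le_mul_of_nonneg_right hm hq0.le
        have h2 : 602 * k * L * q = 301 / 2 * L := by
          rw [show 602 * k * L * q = 602 * L * (q * k) by ring, hqk]; ring
        linarith
      have htq : 4 * (60 * k * L) * q = 60 * L := by
        rw [show 4 * (60 * k * L) * q = 240 * L * (q * k) by ring, hqk]; ring
      have hmq0 : 0 ≤ m * q := by linarith
      have hm0 : 0 ≤ m := by positivity
      have hqle : q * (1 - ((k : ℝ) ^ 11)⁻¹) ≤ q := by
        have : (0 : ℝ) ≤ ((k : ℝ) ^ 11)⁻¹ := by positivity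
        nlinarith
      refine hqle.trans ?_
      rw [htq, le_div_iff₀ (by positivity)]
      -- Here `301` is used: `7/16 · 301/2 > 62`, with `q ≤ 1/8` and `L ≥ 1`.
      have h3 : 2 + 60 * L + m * q * q ≤ 9 / 16 * (m * q) := by nlinarith
      nlinarith
    · have hvZ : v ∉ Z := by
        simp only [hZmem, not_forall, not_not]
        exact ⟨i, hc⟩
      have h1 := (H i).le_bernoulliExp_hasEdgeIn_star hp₀ hp₁ v
      refine le_trans ?_ h1
      have hpv : p v = q := by simp [p, hvZ]
      rw [hpv]
      refine mul_le_mul_of_nonneg_left (sub_le_sub_left ?_ _) hq0.le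
      refine prod_one_sub_le_inv_pow hk 11 hp₁ hrp ?_
      rw [SimpleGraph.card_neighborFinset_eq_degree]
      have h2 := mul_le_mul_of_nonneg_left (hctr i v hc) (by positivity : 0 ≤ 3 / 4 * q)
      -- `45/4 ≥ 11` yields the exponent `11` in `hsurv`.
      have h3 : 3 / 4 * q * (60 * k * L) = 45 / 4 * L := by
        rw [show 3 / 4 * q * (60 * k * L) = 45 * L * (q * k) by ring, hqk]; ring
      push_cast
      linarith
  have hpsum : ∑ v, p v = q * n - q / 4 * Z.card := by
    have h1 : ∀ v, p v = q - if v ∈ Z then q / 4 else 0 := fun v ↦ by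
      simp only [p]; split_ifs <;> ring
    simp only [h1, Finset.sum_sub_distrib, Finset.sum_const, Finset.card_univ, nsmul_eq_mul,
      Finset.sum_ite_mem, Finset.univ_inter, ← hndef]
    ring
  by_contra! hcon
  let Y : Finset V → ℝ := fun S ↦ ∑ i, if (H i).HasEdgeIn S then 1 else 0
  have hY : ∀ S, Y S = (Finset.univ.filter fun i ↦ (H i).HasEdgeIn S).card := fun S ↦ by
    simp only [Y, Finset.sum_boole]
  set τ : ℝ := Real.exp (-(n / k * Real.log 4)) with hτ
  -- Since `τ = 4 ^ (-n/k)`, the right side is at least `n` once `|S| > n/k`; smaller nonempty sets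
  -- have negative excess by `hcon`.
  have hpt : ∀ S, Y S - S.card ≤ n * τ * 4 ^ S.card := by
    intro S
    have hpos : 0 ≤ n * τ * 4 ^ S.card := by positivity
    rcases S.eq_empty_or_nonempty with rfl | hS
    · have : Y ∅ = 0 := Finset.sum_eq_zero fun i _ ↦ if_neg (by simp [SimpleGraph.HasEdgeIn])
      rw [this, Finset.card_empty]
      simp only [Finset.card_empty] at hpos
      simpa using hpos
    · by_cases hc : (S.card : ℝ) ≤ n / k
      · have h1 : Y S < S.card := by rw [hY]; exact_mod_cast hcon S hS hc
        linarith
      · have h1 : Y S ≤ n := by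
          rw [hY, hndef, ← hcard]
          exact_mod_cast Finset.card_le_univ _
        have h2 : (4 : ℝ) ^ S.card = Real.exp (S.card * Real.log 4) := by
          rw [Real.exp_nat_mul, Real.exp_log (by norm_num)]
        have h3 : 1 ≤ τ * 4 ^ S.card := by
          rw [hτ, h2, ← Real.exp_add]
          refine Real.one_le_exp ?_
          have : 0 ≤ Real.log 4 := Real.log_nonneg (by norm_num)
          nlinarith
        have : (0 : ℝ) ≤ S.card := Nat.cast_nonneg _
        nlinarith
  have hE := bernoulliExp.mono hp₀ hp₁ hpt
  rw [bernoulliExp.sub, bernoulliExp.const_mul, bernoulliExp.card, bernoulliExp.pow_card,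
    hpsum] at hE
  have hEY : n * (q * (1 - ((k : ℝ) ^ 11)⁻¹)) ≤ bernoulliExp p Y := by
    simp only [Y]
    rw [bernoulliExp.sum, hndef, ← hcard, ← Finset.card_univ, ← nsmul_eq_mul]
    exact Finset.card_nsmul_le_sum _ _ _ fun i _ ↦ hsurv i
  have hprod : ∏ v, (1 + (4 - 1) * p v) ≤ Real.exp (3 / 4 * (n / k)) := by
    calc _ ≤ ∏ _v : V, Real.exp (3 * q) := by
          refine Finset.prod_le_prod (fun v _ ↦ by linarith [hp₀ v]) fun v _ ↦ ?_
          have := Real.add_one_le_exp (3 * q)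
          linarith [hpq v]
      _ = _ := by
          rw [Finset.prod_const, Finset.card_univ, ← Real.exp_nat_mul, ← hndef, hq]
          congr 1; field_simp
  have htail : τ * Real.exp (3 / 4 * (n / k)) ≤ ((k : ℝ) ^ 12)⁻¹ := by
    rw [hτ, ← Real.exp_add]
    have hlog : (5 / 4 : ℝ) ≤ Real.log 4 := by
      rw [show (4 : ℝ) = 2 ^ 2 by norm_num, Real.log_pow]
      have := Real.log_two_gt_d9
      push_cast; linarith
    have hnk : 602 * L ≤ n / k := by
      rw [le_div_iff₀ hk0]; linarith
    rw [show -(n / k * Real.log 4) + 3 / 4 * (n / k) = -(n / k * (Real.log 4 - 3 / 4)) by ring]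
    refine exp_neg_le_inv_pow hk 12 ?_
    push_cast
    nlinarith
  have hE' : n * (q * (1 - ((k : ℝ) ^ 11)⁻¹)) - (q * n - q / 4 * Z.card)
      ≤ n * ((k : ℝ) ^ 12)⁻¹ := by
    refine (sub_le_sub_right hEY _).trans (hE.trans ?_)
    rw [mul_assoc]
    refine mul_le_mul_of_nonneg_left (le_trans ?_ htail) hn0.le
    exact mul_le_mul_of_nonneg_left hprod (by positivity)
  -- The gain `n/(128k²)` from `Z` must beat the total error `(5/4) n k⁻¹²`, which holds as `k¹⁰ ≥
  -- 1024`.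
  have hZ' : q / 4 * (n / (8 * k)) < q / 4 * Z.card := mul_lt_mul_of_pos_left hZ (by positivity)
  have h5 : n * (q / (32 * k)) < n * (q * ((k : ℝ) ^ 11)⁻¹ + ((k : ℝ) ^ 12)⁻¹) := by
    have : q / 4 * (n / (8 * k)) = n * (q / (32 * k)) := by field_simp; ring
    linarith
  have h6 := lt_of_mul_lt_mul_left h5 hn0.le
  have h7 : q / (32 * k) = (k : ℝ) ^ 10 / 128 * ((k : ℝ) ^ 12)⁻¹ := by
    rw [hq]; field_simp; ring
  have h8 : q * ((k : ℝ) ^ 11)⁻¹ + ((k : ℝ) ^ 12)⁻¹ = 5 / 4 * ((k : ℝ) ^ 12)⁻¹ := by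
    rw [hq]; field_simp; ring
  rw [h7, h8] at h6
  have h9 := lt_of_mul_lt_mul_right h6 (by positivity)
  have h10 : (2 : ℝ) ^ 10 ≤ (k : ℝ) ^ 10 := pow_le_pow_left₀ (by norm_num) hk2 10
  norm_num at h10
  linarith

end Spanning

/-! ### Colour classes and the conclusion. -/

/-- The subgraph of `G` formed by the edges of colour `i`. -/
def SimpleGraph.colorGraph {V α : Type*} (G : SimpleGraph V) (c : G.edgeSet → α) (i : α) :
    SimpleGraph V where
  Adj u v := ∃ h : G.Adj u v, c ⟨s(u, v), h⟩ = i
  symm := ⟨fun u v ⟨h, hi⟩ ↦ ⟨h.symm, by rw [← hi]; congr 2; exact Sym2.eq_swap⟩⟩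
  loopless := ⟨fun _ ⟨h, _⟩ ↦ h.ne rfl⟩

theorem SimpleGraph.edgeSet_colorGraph {V α : Type*} (G : SimpleGraph V) (c : G.edgeSet → α)
    (i : α) : (G.colorGraph c i).edgeSet = Subtype.val '' (c ⁻¹' {i}) := by
  ext e
  induction e with
  | h u v =>
    simp only [mem_edgeSet, colorGraph, Set.mem_image, Set.mem_preimage, Set.mem_singleton_iff,
      Subtype.exists, exists_and_right, exists_eq_right]

open Classical in
theorem SimpleGraph.sum_degree_colorGraph {V α : Type*} [Fintype V] (G : SimpleGraph V)
    (c : G.edgeSet → α) (i : α) :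
    ∑ v, (G.colorGraph c i).degree v = 2 * (c ⁻¹' {i}).ncard := by
  rw [sum_degrees_eq_twice_card_edges, ← Set.ncard_coe_finset, coe_edgeFinset,
    edgeSet_colorGraph, Set.ncard_image_of_injective _ Subtype.val_injective]

/-- The `n` disjoint classes fit into at most `n(n-1)/2` edges. This makes `n/k` large enough for
the tail estimate. -/
theorem SimpleGraph.two_mul_le_card_of_le_ncard_color {V α : Type*} [Fintype V] [Nonempty V]
    [Fintype α] (hα : Fintype.card α = Fintype.card V) (G : SimpleGraph V) (c : G.edgeSet → α)
    {x : ℝ} (hc : ∀ i, x ≤ ((c ⁻¹' {i}).ncard : ℝ)) : 2 * x ≤ Fintype.card V := by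
  classical
  have h1 : ∑ i, (c ⁻¹' {i}).ncard = G.edgeFinset.card := by
    rw [edgeFinset_card, ← Finset.card_univ,
      Finset.card_eq_sum_card_fiberwise (f := c) (t := Finset.univ) fun _ _ ↦ Finset.mem_univ _]
    refine Finset.sum_congr rfl fun i _ ↦ ?_
    rw [← Set.ncard_coe_finset]
    congr 1
    ext e; simp
  have h2 := G.card_edgeFinset_le_card_choose_two
  have h3 : (G.edgeFinset.card : ℝ) ≤ Fintype.card V * (Fintype.card V - 1) / 2 := by
    rw [← Nat.cast_choose_two]
    exact_mod_cast h2
  have h4 : Fintype.card V * x ≤ (G.edgeFinset.card : ℝ) := by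
    rw [← h1, ← hα, ← Finset.card_univ, ← nsmul_eq_mul]
    push_cast
    exact Finset.card_nsmul_le_sum _ _ _ fun i _ ↦ hc i
  have hn : (0 : ℝ) < Fintype.card V := by exact_mod_cast Fintype.card_pos
  nlinarith

theorem theorem2p1 {V : Type*} [Fintype V] [Nonempty V] (G : SimpleGraph V) (k : ℕ) (hk : 1 < k)
    (c : G.edgeSet → Fin (Fintype.card V))
    (hc : ∀ i : Fin (Fintype.card V),
      301 * (k : ℝ) * Real.logb 2 (k : ℝ) ≤ ((c ⁻¹' {i}).ncard : ℝ)) :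
    ∃ (v : V) (p : G.Walk v v),
      p.IsRainbowCycle c ∧ p.length ≤ ⌈(Fintype.card V : ℝ) / (k : ℝ)⌉₊ := by
  classical
  have hk0 : (0 : ℝ) < k := by exact_mod_cast (by omega : 0 < k)
  have hL := one_le_logb_two_natCast hk
  have hcard : Fintype.card (Fin (Fintype.card V)) = Fintype.card V := Fintype.card_fin _
  have hn := G.two_mul_le_card_of_le_ncard_color hcard c hc
  have hH : ∀ i, 602 * k * Real.logb 2 (k : ℝ) ≤ ∑ v, ((G.colorGraph c i).degree v : ℝ) := by
    intro i
    have h1 : ∑ v, ((G.colorGraph c i).degree v : ℝ) = 2 * (c ⁻¹' {i}).ncard := by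
      exact_mod_cast G.sum_degree_colorGraph c i
    linarith [hc i]
  have hedge : ∀ i, ∃ u v, (G.colorGraph c i).Adj u v := by
    intro i
    have h0 : (0 : ℝ) < 602 * k * Real.logb 2 (k : ℝ) := by positivity
    obtain ⟨u, -, hu⟩ := Finset.exists_ne_zero_of_sum_ne_zero (h0.trans_le (hH i)).ne'
    obtain ⟨v, hv⟩ := (SimpleGraph.degree_pos_iff_exists_adj _ u).mp
      (Nat.pos_of_ne_zero fun h ↦ hu (by rw [h, Nat.cast_zero]))
    exact ⟨u, v, hv⟩
  have hctr : ∀ i, ∃ o : Option V,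
      (∀ v, o = some v → 60 * k * Real.logb 2 (k : ℝ) ≤ (G.colorGraph c i).degree v) ∧
      (o = none → ∀ v, ((G.colorGraph c i).degree v : ℝ) ≤ 60 * k * Real.logb 2 (k : ℝ)) := by
    intro i
    by_cases h : ∃ v, 60 * k * Real.logb 2 (k : ℝ) ≤ (G.colorGraph c i).degree v
    · obtain ⟨v, hv⟩ := h
      exact ⟨some v, fun w hw ↦ Option.some.inj hw ▸ hv, fun h ↦ by simp at h⟩
    · push Not at h
      exact ⟨none, fun v hv ↦ by simp at hv, fun _ v ↦ (h v).le⟩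
  choose ctr hsome hnone using hctr
  obtain ⟨S, hS, hSn, hSc⟩ : ∃ S : Finset V, S.Nonempty ∧ (S.card : ℝ) ≤ Fintype.card V / k ∧
      S.card ≤ (Finset.univ.filter fun i ↦ (G.colorGraph c i).HasEdgeIn S).card := by
    obtain ⟨Z, hZmem⟩ : ∃ Z : Finset V, ∀ v, v ∈ Z ↔ ∀ i, ctr i ≠ some v :=
      ⟨Finset.univ.filter fun v ↦ ∀ i, ctr i ≠ some v, fun v ↦ Finset.mem_filter_univ v⟩
    rcases le_or_gt (Z.card : ℝ) (Fintype.card V / (8 * k)) with hZ | hZ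
    · exact exists_spanning_of_few_noncentres hcard hk hedge hsome hZmem hZ
    · exact exists_spanning_of_many_noncentres hcard hk (by linarith) hH hsome hnone hZmem hZ
  obtain ⟨v, p, hp, hpS⟩ := SimpleGraph.exists_isRainbowCycle_length_le_card c hS hSc
    (fun i hi ↦ (Finset.mem_filter.mp hi).2)
  exact ⟨v, p, hp, hpS.trans (Nat.cast_le.mp (hSn.trans (Nat.le_ceil _)))⟩
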